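/- **Setting.** Let $A=\mathbb{Z}[x_s,x_t]$. For a color $c\in\{s,t\}$ let $c'$ be the other color. The two-colored quantum numbers in $A$ are given by $[0]_c=0$, $[1]_c=1$, $[n+1]_c=[n]_{c'}\,x_c-[n-1]_c$ (so $[2]_c=x_c$). Let $\Bbbk$ be an $A$-algebra that is a commutative domain and a Henselian local ring; write $[n]_c$ also for the image of $[n]_c$ in $\Bbbk$. The two-colored Temperley–Lieb category over $\Bbbk$ has objects $n_c$ ($n\ge 0$, $c\in\{s,t\}$): $n$ points on a line, whose $n+1$ complementary regions are colored alternately by $s$ and $t$, the rightmost one by $c$. $\mathrm{Hom}(n_c,m_c)$ is the free $\Bbbk$-module on the crossingless matchings with $n$ bottom and $m$ top points whose regions are colored so that adjacent regions differ and the far right region has color $c$. Composition is vertical stacking, where a circle of color $c'$ lying inside a region of color $c$ is evaluated to $-x_c$. A *top idempotent* of $n_c$ is an idempotent $e\in\mathrm{End}(n_c)$ that occurs in some decomposition of $1_{n_c}$ into orthogonal indecomposable idempotents and has a nonzero coefficient of the identity matching. A *Jones–Wenzl projector* $JW_{n_c}$ is a top idempotent $e$ of $n_c$ with $e\circ\mathrm{Hom}(k_c,n_c)=0$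 for all $0\le k<n$. One says that $JW_n$ *exists* if both $JW_{n_s}$ and $JW_{n_t}$ exist. For $n\ge 1$, the *partial trace* $\mathrm{ptr}\colon\mathrm{End}(n_c)\to\mathrm{End}((n-1)_{c'})$ connects the rightmost top point to the rightmost bottom point by an arc around the right hand side; if $JW_n$ exists, it is *rotatable* if $\mathrm{ptr}(JW_{n_s})=0$ and $\mathrm{ptr}(JW_{n_t})=0$. *Counterclockwise rotation by one strand* $\mathrm{End}(n_c)\to\mathrm{End}(n_{c'})$ bends the leftmost top strand down to the left, to become the leftmost bottom strand, and the rightmost bottom strand up to the right, to become the rightmost top strand; *clockwise rotation* is the mirror image of this. Rotation by two strands is rotation by one strand applied twice. **Lemma 6.9.** Let $n\ge 1$ and suppose that $JW_n$ exists and is rotatable. Then: 1. The rotation of $JW_{n_s}$ by one strand, clockwise or counterclockwise, is equal to $[n]_t\,JW_{n_t}$, and the rotation of $JW_{n_t}$ by one strand, clockwise or counterclockwise, is equal to $[n]_s\,JW_{n_s}$. 2. $[n]_s[n]_t=1$, and the rotation of $JW_{n_s}$ (respectively $JW_{n_t}$) by two strands, clockwise or counterclockwise, is again $JW_{n_s}$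 (respectively $JW_{n_t}$). 3. If $n$ is odd, then $[n]_s=[n]_t=1$. -/

import Mathlib

noncomputable section

namespace TwoColorTL

/-! ### Colors and two-colored quantum numbers -/

/-- The two colors: `s` (red) and `t` (blue). -/
inductive Color
  | s
  | t

/-- The other color. -/
def Color.swap : Color → Color
  | .s => .t
  | .t => .s

/-- The ring `A = ℤ[x_s, x_t]`. -/
abbrev A : Type := MvPolynomial Color ℤ

/-- The two-colored quantum numbers `[n]_c` in `A`: `[0]_c = 0`, `[1]_c = 1` and
`[n+1]_c = [n]_{c'} x_c - [n-1]_c`, where `c'` is the other color; so `[2]_c = x_c`. -/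
def qnum : ℕ → Color → A
  | 0, _ => 0
  | 1, _ => 1
  | n + 2, c => qnum (n + 1) c.swap * MvPolynomial.X c - qnum n c

/-! ### Crossingless matchings -/

/-- A crossingless matching of `N` points `0, …, N-1` on the boundary of a disc, listed clockwise:
a fixed-point free involution `partner` without crossing arcs. (The value `partner i = i` for
`i ≥ N` is a normalization, so that a matching is determined by its arcs.) -/
@[ext]
structure Matching (N : ℕ) where
  partner : ℕ → ℕ
  partner_lt : ∀ i, i < N → partner i < N
  partner_ne : ∀ i, i < N → partner i ≠ i
  partner_of_ge : ∀ i, N ≤ i → partner i = i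
  partner_partner : ∀ i, partner (partner i) = i
  noncrossing : ∀ i j, ¬ (i < j ∧ j < partner i ∧ partner i < partner j)

namespace Matching

/-- The same matching, for an equal number of points. -/
def cast {L N : ℕ} (h : L = N) (M : Matching L) : Matching N where
  partner := M.partner
  partner_lt := by subst h; exact M.partner_lt
  partner_ne := by subst h; exact M.partner_ne
  partner_of_ge := by subst h; exact M.partner_of_ge
  partner_partner := M.partner_partner
  noncrossing := M.noncrossing

/-- The identity `(n, n)`-matching, see the convention in `Hom`: the `i`-th top point from the left
is the point `i`, the `i`-th bottom point from the left is the point `2n - 1 - i`, and the two are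
joined. -/
def id (n : ℕ) : Matching (n + n) where
  partner i := if i < n + n then n + n - 1 - i else i
  partner_lt i hi := by simp only [hi, if_true]; omega
  partner_ne i hi := by simp only [hi, if_true]; omega
  partner_of_ge i hi := by simp only [if_neg (not_lt.mpr hi)]
  partner_partner i := by grind
  noncrossing i j := by grind

/-- Juxtaposition: the points of `M` followed by the points of `L`. -/
def juxtapose {a b : ℕ} (M : Matching a) (L : Matching b) : Matching (a + b) where
  partner i := if i < a then M.partner i else L.partner (i - a) + a
  partner_lt i hi := by
    have h1 := M.partner_lt i
    have h2 := L.partner_lt (i - a)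
    grind
  partner_ne i hi := by
    have h1 := M.partner_ne i
    have h2 := L.partner_ne (i - a)
    grind
  partner_of_ge i hi := by
    have h2 := L.partner_of_ge (i - a)
    grind
  partner_partner i := by
    have h1 := M.partner_lt i
    have h2 := M.partner_partner i
    have h3 := L.partner_partner (i - a)
    grind
  noncrossing i j := by
    have h1 := M.partner_lt i
    have h2 := M.noncrossing i j
    have h3 := L.noncrossing (i - a) (j - a)
    grind

/-- Renumbering after the points `p` and `p + 1` have been inserted. -/
def insertTwo (p k : ℕ) : ℕ := if k < p then k else k + 2

/-- Renumbering after the points `p` and `p + 1` have been removed. -/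
def removeTwo (p k : ℕ) : ℕ := if k < p then k else k - 2

/-- The partner function after the points `p` and `p + 1` have been joined and removed. -/
def joinFun (f : ℕ → ℕ) (p i : ℕ) : ℕ :=
  if f (insertTwo p i) = p then removeTwo p (f (p + 1))
  else if f (insertTwo p i) = p + 1 then removeTwo p (f p)
  else removeTwo p (f (insertTwo p i))

theorem joinFun_spec {L : ℕ} (M : Matching L) (p i : ℕ) (hp : p + 1 < L) :
    (M.partner (insertTwo p i) = p ∧
      insertTwo p (joinFun M.partner p i) = M.partner (p + 1) ∧ M.partner (p + 1) ≠ p) ∨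
    (M.partner (insertTwo p i) = p + 1 ∧
      insertTwo p (joinFun M.partner p i) = M.partner p ∧ M.partner p ≠ p + 1) ∨
    (M.partner (insertTwo p i) ≠ p ∧ M.partner (insertTwo p i) ≠ p + 1 ∧
      insertTwo p (joinFun M.partner p i) = M.partner (insertTwo p i)) := by
  have key : ∀ k, k ≠ p → k ≠ p + 1 → insertTwo p (removeTwo p k) = k := by
    intro k h1 h2
    unfold insertTwo removeTwo
    split_ifs <;> omega
  have hne : insertTwo p i ≠ p ∧ insertTwo p i ≠ p + 1 := by
    unfold insertTwo
    split_ifs <;> omega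
  have e := M.partner_partner (insertTwo p i)
  have e0 := M.partner_partner p
  have e1 := M.partner_partner (p + 1)
  have n0 := M.partner_ne p (by omega)
  have n1 := M.partner_ne (p + 1) hp
  unfold joinFun
  split_ifs with h1 h2
  · left
    have h3 : M.partner (p + 1) ≠ p := fun h => by rw [h1] at e; rw [h] at e1; omega
    exact ⟨h1, key _ h3 n1, h3⟩
  · right; left
    have h3 : M.partner p ≠ p + 1 := fun h => by rw [h2] at e; rw [h] at e0; omega
    exact ⟨h2, key _ n0 h3, h3⟩
  · right; right
    exact ⟨h1, h2, key _ h1 h2⟩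

theorem insertTwo_spec (p i : ℕ) :
    (i < p ∧ insertTwo p i = i) ∨ (p ≤ i ∧ insertTwo p i = i + 2) := by
  unfold insertTwo
  split_ifs <;> omega

/-- Join the neighbouring boundary points `p` and `p + 1` by a small arc outside the disc, forget
them, and renumber the other points. If `p` and `p + 1` are not partners, then their partners
become partners; if they are partners, then a circle is formed, which is dropped here and is
accounted for in `capOff`. -/
def join {L N : ℕ} (hN : L = N + 2) (p : ℕ) (hp : p ≤ N) (M : Matching L) : Matching N where
  partner := joinFun M.partner p
  partner_lt i hi := by
    have h0 := insertTwo_spec p i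
    have h1 := insertTwo_spec p (joinFun M.partner p i)
    have h2 := M.partner_lt (insertTwo p i) (by omega)
    have h3 := M.partner_lt p (by omega)
    have h4 := M.partner_lt (p + 1) (by omega)
    rcases M.joinFun_spec p i (by omega) with h | h | h <;> omega
  partner_ne i hi := by
    intro hi'
    have h0 := insertTwo_spec p i
    have h2 := M.partner_ne (insertTwo p i) (by omega)
    have h3 := M.partner_partner p
    have h4 := M.partner_partner (p + 1)
    have h5 := M.joinFun_spec p i (by omega)
    rw [hi'] at h5
    rcases h5 with ⟨h6, h7, h8⟩ | ⟨h6, h7, h8⟩ | ⟨h6, h7, h8⟩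
    · rw [← h7, h6] at h4; omega
    · rw [← h7, h6] at h3; omega
    · exact h2 h8.symm
  partner_of_ge i hi := by
    have h0 := insertTwo_spec p i
    have h1 := insertTwo_spec p (joinFun M.partner p i)
    have h2 := M.partner_of_ge (insertTwo p i) (by omega)
    rcases M.joinFun_spec p i (by omega) with h | h | h <;> omega
  partner_partner i := by
    have h0 := insertTwo_spec p i
    have h1 := insertTwo_spec p (joinFun M.partner p i)
    have h2 := insertTwo_spec p (joinFun M.partner p (joinFun M.partner p i))
    have h3 := M.partner_partner p
    have h4 := M.partner_partner (p + 1)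
    have h5 := M.partner_partner (insertTwo p i)
    have h6 := M.joinFun_spec p (joinFun M.partner p i) (by omega)
    rcases M.joinFun_spec p i (by omega) with ⟨h7, h8, h9⟩ | ⟨h7, h8, h9⟩ | ⟨h7, h8, h9⟩
    · rw [h7] at h5; rw [h8, h4] at h6; omega
    · rw [h7] at h5; rw [h8, h3] at h6; omega
    · rw [h9, h5] at h6; omega
  noncrossing i j := by
    rintro ⟨hij, hji, hc⟩
    have a0 := insertTwo_spec p i
    have a1 := insertTwo_spec p j
    have a2 := insertTwo_spec p (joinFun M.partner p i)
    have a3 := insertTwo_spec p (joinFun M.partner p j)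
    have b0 := M.partner_partner p
    have b1 := M.partner_partner (p + 1)
    have b2 := M.partner_partner (insertTwo p i)
    have b3 := M.partner_partner (insertTwo p j)
    have nc := M.noncrossing
    have si := M.joinFun_spec p i (by omega)
    have sj := M.joinFun_spec p j (by omega)
    generalize insertTwo p i = a at *
    generalize insertTwo p j = b at *
    generalize insertTwo p (joinFun M.partner p i) = c at *
    generalize insertTwo p (joinFun M.partner p j) = d at *
    have hab : a < b := by omega
    have hbc : b < c := by omega
    have hcd : c < d := by omega
    have ha : a ≠ p ∧ a ≠ p + 1 := by omega
    have hb : b ≠ p ∧ b ≠ p + 1 := by omega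
    have hc' : c ≠ p ∧ c ≠ p + 1 := by omega
    have hd : d ≠ p ∧ d ≠ p + 1 := by omega
    clear a0 a1 a2 a3 hij hji hc
    rcases si with ⟨h1, h2, h3⟩ | ⟨h1, h2, h3⟩ | ⟨h1, h2, h3⟩ <;>
      rcases sj with ⟨k1, k2, k3⟩ | ⟨k1, k2, k3⟩ | ⟨k1, k2, k3⟩
    all_goals
      have n1 := nc a b
      have n2 := nc p b
      have n3 := nc (p + 1) b
      have n4 := nc a p
      have n5 := nc a (p + 1)
      have n6 := nc b p
      have n7 := nc b (p + 1)
      have n8 := nc b c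
      have n9 := nc p d
      have m1 := nc p c
      have m2 := nc (p + 1) c
      have m3 := nc c p
      have m4 := nc c (p + 1)
      have m5 := nc (p + 1) d
      have m6 := nc a d
      have l1 := nc p a
      have l2 := nc (p + 1) a
      have l3 := nc p (p + 1)
      clear nc
      simp only [h1, h2, h3, k1, k2, k3] at *
      grind

/-- The next of the `N` points in cyclic order. -/
def next (N k : ℕ) : ℕ := if k + 1 = N then 0 else k + 1

/-- The previous of the `N` points in cyclic order. -/
def prev (N k : ℕ) : ℕ := if k = 0 then N - 1 else k - 1

theorem next_spec (N k : ℕ) : (k + 1 = N ∧ next N k = 0) ∨ (k + 1 ≠ N ∧ next N k = k + 1) := by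
  unfold next
  split_ifs <;> omega

theorem prev_spec (N k : ℕ) : (k = 0 ∧ prev N k = N - 1) ∨ (k ≠ 0 ∧ prev N k = k - 1) := by
  unfold prev
  split_ifs <;> omega

/-- Counterclockwise rotation: the point `i + 1` becomes the point `i`, and the point `0` becomes
the last point. -/
def rotateCCW {N : ℕ} (M : Matching N) : Matching N where
  partner i := if i < N then prev N (M.partner (next N i)) else i
  partner_lt i hi := by
    have h0 := next_spec N i
    have h1 := prev_spec N (M.partner (next N i))
    have h2 := M.partner_lt (next N i) (by omega)
    simp only [hi, if_true]
    omega
  partner_ne i hi := by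
    have h0 := next_spec N i
    have h1 := prev_spec N (M.partner (next N i))
    have h2 := M.partner_lt (next N i) (by omega)
    have h3 := M.partner_ne (next N i) (by omega)
    simp only [hi, if_true]
    omega
  partner_of_ge i hi := by simp only [if_neg (not_lt.mpr hi)]
  partner_partner i := by
    by_cases hi : i < N
    · have h0 := next_spec N i
      have h1 := prev_spec N (M.partner (next N i))
      have h2 := M.partner_lt (next N i) (by omega)
      have h3 := next_spec N (prev N (M.partner (next N i)))
      have h4 : next N (prev N (M.partner (next N i))) = M.partner (next N i) := by omega
      have h5 := prev_spec N (next N i)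
      simp only [hi, if_true, show prev N (M.partner (next N i)) < N by omega, h4,
        M.partner_partner]
      omega
    · simp only [hi, if_false]
  noncrossing i j := by
    rintro ⟨hij, hji, hc⟩
    by_cases hi : i < N
    · simp only [hi, if_true] at hji hc
      have h0 := next_spec N i
      have h1 := prev_spec N (M.partner (next N i))
      have h2 := M.partner_lt (next N i) (by omega)
      have hj : j < N := by omega
      simp only [hj, if_true] at hc
      have k0 := next_spec N j
      have k1 := prev_spec N (M.partner (next N j))
      have k2 := M.partner_lt (next N j) (by omega)
      have e1 := M.partner_partner (next N i)
      have e2 := M.partner_partner (next N j)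
      have n1 := M.noncrossing (next N i) (next N j)
      have n2 := M.noncrossing (M.partner (next N j)) (next N i)
      have n3 := M.noncrossing (next N j) (M.partner (next N i))
      rw [e1] at n3
      rw [e2] at n2
      omega
    · simp only [hi, if_false] at hji
      omega

/-- Clockwise rotation: the point `i` becomes the point `i + 1`, and the last point becomes the
point `0`. -/
def rotateCW {N : ℕ} (M : Matching N) : Matching N where
  partner i := if i < N then next N (M.partner (prev N i)) else i
  partner_lt i hi := by
    have h0 := prev_spec N i
    have h1 := next_spec N (M.partner (prev N i))
    have h2 := M.partner_lt (prev N i) (by omega)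
    simp only [hi, if_true]
    omega
  partner_ne i hi := by
    have h0 := prev_spec N i
    have h1 := next_spec N (M.partner (prev N i))
    have h2 := M.partner_lt (prev N i) (by omega)
    have h3 := M.partner_ne (prev N i) (by omega)
    simp only [hi, if_true]
    omega
  partner_of_ge i hi := by simp only [if_neg (not_lt.mpr hi)]
  partner_partner i := by
    by_cases hi : i < N
    · have h0 := prev_spec N i
      have h1 := next_spec N (M.partner (prev N i))
      have h2 := M.partner_lt (prev N i) (by omega)
      have h3 := prev_spec N (next N (M.partner (prev N i)))
      have h4 : prev N (next N (M.partner (prev N i))) = M.partner (prev N i) := by omega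
      have h5 := next_spec N (prev N i)
      simp only [hi, if_true, show next N (M.partner (prev N i)) < N by omega, h4,
        M.partner_partner]
      omega
    · simp only [hi, if_false]
  noncrossing i j := by
    rintro ⟨hij, hji, hc⟩
    by_cases hi : i < N
    · simp only [hi, if_true] at hji hc
      have h0 := prev_spec N i
      have h1 := next_spec N (M.partner (prev N i))
      have h2 := M.partner_lt (prev N i) (by omega)
      have hj : j < N := by omega
      simp only [hj, if_true] at hc
      have k0 := prev_spec N j
      have k1 := next_spec N (M.partner (prev N j))
      have k2 := M.partner_lt (prev N j) (by omega)
      have e1 := M.partner_partner (prev N i)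
      have e2 := M.partner_partner (prev N j)
      have n1 := M.noncrossing (prev N i) (prev N j)
      have n2 := M.noncrossing (M.partner (prev N j)) (prev N i)
      have n3 := M.noncrossing (prev N j) (M.partner (prev N i))
      rw [e1] at n3
      rw [e2] at n2
      omega
    · simp only [hi, if_false] at hji
      omega

end Matching

/-! ### The two-colored Temperley-Lieb category -/

section TL

variable (𝕜 : Type*) [CommRing 𝕜] [Algebra A 𝕜]

/-- The image of the quantum number `[n]_c` in the `A`-algebra `𝕜`. -/
def quantum (n : ℕ) (c : Color) : 𝕜 := algebraMap A 𝕜 (qnum n c)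

/-- The value `-x_c` of a circle of the other color lying inside a region of color `c`. -/
def circleValue (c : Color) : 𝕜 := -algebraMap A 𝕜 (MvPolynomial.X c)

/-- `Hom 𝕜 c n m` is the morphism space from `n_c` to `m_c`: the free `𝕜`-module on the
two-colored `(n, m)`-crossingless matchings with color `c` on the far right.

An `(n, m)`-matching has `m` points on top and `n` points on the bottom. The boundary points are
numbered clockwise from the left: the top points from left to right are `0, …, m-1`, and the bottom
points from right to left are `m, …, m+n-1`. Adjacent regions have different colors, so the
coloring is determined by the color `c` on the far right, that is, of the region meeting the
boundary between the points `m-1` and `m`. -/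
@[nolint unusedArguments]
abbrev Hom (_c : Color) (n m : ℕ) : Type _ := Matching (m + n) →₀ 𝕜

variable {𝕜}

/-- Linear extension of `Matching.join`: join the neighbouring points `p` and `p + 1`. If a circle
is formed, it is evaluated as `circleValue 𝕜 outer`, where `outer` has to be the color of the region
just before the point `p`, which is the region outside that circle. -/
def capOff {L N : ℕ} (hN : L = N + 2) (p : ℕ) (hp : p ≤ N) (outer : Color) :
    (Matching L →₀ 𝕜) →ₗ[𝕜] (Matching N →₀ 𝕜) :=
  Finsupp.linearCombination 𝕜 fun M =>
    Finsupp.single (M.join hN p hp) (if M.partner p = p + 1 then circleValue 𝕜 outer else 1)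

/-- Gluing along `m` strands, from left to right. The `(k + m) + (m + n)` points are: the `k` top
points of the upper diagram, its `m` bottom points from right to left, the `m` top points of the
lower diagram from left to right, and the `n` bottom points of the lower diagram. The leftmost of
`m + 1` strands joins the points `k + m` and `k + m + 1`. A circle closes up at its rightmost
strand; there are then `m` strands to the right of it, so the region right of it, which is outside
the circle, has the color `c` of the far right, swapped `m` times. -/
def glue (c : Color) (k n : ℕ) : (m : ℕ) →
    (Matching ((k + m) + (m + n)) →₀ 𝕜) →ₗ[𝕜] (Matching (k + n) →₀ 𝕜)
  | 0 => Finsupp.lmapDomain 𝕜 𝕜 (Matching.cast (by omega))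
  | m + 1 => glue c k n m ∘ₗ capOff (by omega) (k + m) (by omega) (Color.swap^[m] c)

/-- Composition `f ∘ g` in the two-colored Temperley-Lieb category: stack `f` on top of `g`. -/
def comp (c : Color) {n m k : ℕ} (f : Hom 𝕜 c m k) (g : Hom 𝕜 c n m) : Hom 𝕜 c n k :=
  glue c k n m (f.sum fun β b => g.sum fun α a => Finsupp.single (β.juxtapose α) (b * a))

variable (𝕜) in
/-- The identity morphism of `n_c`. -/
def one (c : Color) (n : ℕ) : Hom 𝕜 c n n := Finsupp.single (Matching.id n) 1

/-- The partial trace `End(n_c) → End((n-1)_{c'})`, `c'` the other color: connect the rightmost top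
point to the rightmost bottom point around the right hand side. The region to the left of the
rightmost strand, which becomes the far right region, has the color `c'`. -/
def ptr (c : Color) {n : ℕ} (hn : 1 ≤ n) : Hom 𝕜 c n n →ₗ[𝕜] Hom 𝕜 c.swap (n - 1) (n - 1) :=
  capOff (by omega) (n - 1) (by omega) c.swap

/-- Counterclockwise rotation by one strand, `End(n_c) → End(n_{c'})`: the leftmost top strand is
bent down to the left and becomes the leftmost bottom strand, the rightmost bottom strand is bent up
to the right and becomes the rightmost top strand. -/
def rotCCW (c : Color) {n : ℕ} : Hom 𝕜 c n n →ₗ[𝕜] Hom 𝕜 c.swap n n :=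
  Finsupp.lmapDomain 𝕜 𝕜 Matching.rotateCCW

/-- Clockwise rotation by one strand, `End(n_c) → End(n_{c'})`: the rightmost top strand is bent
down to the right, and the leftmost bottom strand is bent up to the left. -/
def rotCW (c : Color) {n : ℕ} : Hom 𝕜 c n n →ₗ[𝕜] Hom 𝕜 c.swap n n :=
  Finsupp.lmapDomain 𝕜 𝕜 Matching.rotateCW

/-! ### Jones-Wenzl projectors -/

/-- `e` is an idempotent endomorphism of `n_c`. -/
def IsIdempotent (c : Color) {n : ℕ} (e : Hom 𝕜 c n n) : Prop := comp c e e = e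

/-- `e` is an indecomposable idempotent: it is nonzero, and not a sum of two nonzero orthogonal
idempotents. -/
def IsIndecomposable (c : Color) {n : ℕ} (e : Hom 𝕜 c n n) : Prop :=
  IsIdempotent c e ∧ e ≠ 0 ∧
    ∀ f g : Hom 𝕜 c n n, IsIdempotent c f → IsIdempotent c g →
      comp c f g = 0 → comp c g f = 0 → e = f + g → f = 0 ∨ g = 0

/-- `e` is a top idempotent of `n_c`: it belongs to a decomposition of the identity into orthogonal
indecomposable idempotents, and its coefficient of the identity matching is nonzero. -/
def IsTopIdempotent (c : Color) {n : ℕ} (e : Hom 𝕜 c n n) : Prop :=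
  (∃ (d : ℕ) (E : Fin d → Hom 𝕜 c n n),
    (∀ i, IsIndecomposable c (E i)) ∧ (∀ i j, i ≠ j → comp c (E i) (E j) = 0) ∧
    ∑ i, E i = one 𝕜 c n ∧ ∃ i, E i = e) ∧
  e (Matching.id n) ≠ 0

/-- `e` is a Jones-Wenzl projector `JW_{n_c}`: a top idempotent such that
`e ∘ Hom(k_c, n_c) = 0` for all `k < n`. -/
def IsJonesWenzl (c : Color) {n : ℕ} (e : Hom 𝕜 c n n) : Prop :=
  IsTopIdempotent c e ∧ ∀ k, k < n → ∀ g : Hom 𝕜 c k n, comp c e g = 0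

end TL

end TwoColorTL

end

/-! A matching on n strands other than the identity has a small arc at its top. So an endomorphism v
killed by all bottom caps satisfies v ∘ g = g(1) v, where g(1) is the coefficient of the identity
matching. Combined with reflection in a horizontal line this gives z(1) v = v(1) z for z killed by
all top caps (`BotKilled.smul_eq_smul`). A Jones–Wenzl projector is killed from below; being a
nonzero idempotent it has identity coefficient 1 (this cancels in a domain), so it equals its own
mirror image and is killed from above too. After a counterclockwise rotation the top caps of JW
become its other top caps, except for the rightmost one, which becomes the partial trace.
Rotatability therefore makes the rotated projector top-killed, hence a multiple of the projector of
the other color (`IsJonesWenzl.rotCCW_eq`). The factor is a coefficient of JW at a "hook", the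
identity of n-1 strands with one small arc inserted. Taking the identity coefficient of a cap
relates three consecutive hooks (`capOff_apply_id`) by the recursion of the quantum numbers. The
last hook is the identity, so the first one has coefficient inverse to [n]_c. One more step of the
recursion, at the partial trace, gives [n+1] = 0, and the identity [n]_s[n]_t - [n+1]_s[n-1]_t = 1
then yields [n]_s[n]_t = 1. For odd n, rotation by n strands fixes the identity matching but takes
JW_s to [n]_t JW_t, so [n]_t = 1. -/

namespace TwoColorTL
namespace Matching

/-! ### Planar surgery on matchings: parity, small arcs, joins, reflection, rotation. -/

/-- Insert a small arc joining two new neighbouring points `p` and `p + 1`. -/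
def insertArc {N L : ℕ} (hN : L = N + 2) (p : ℕ) (hp : p ≤ N) (M : Matching N) : Matching L where
  partner i := if i = p then p + 1 else if i = p + 1 then p
    else insertTwo p (M.partner (removeTwo p i))
  partner_lt i hi := by
    have h := M.partner_lt (removeTwo p i)
    unfold insertTwo removeTwo at *
    grind
  partner_ne i hi := by
    have h := M.partner_ne (removeTwo p i)
    unfold insertTwo removeTwo at *
    grind
  partner_of_ge i hi := by
    have h := M.partner_of_ge (removeTwo p i)
    unfold insertTwo removeTwo at *
    grind
  partner_partner i := by
    have h := M.partner_partner (removeTwo p i)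
    unfold insertTwo removeTwo at *
    grind
  noncrossing i j := by
    have h := M.noncrossing (removeTwo p i) (removeTwo p j)
    unfold insertTwo removeTwo at *
    grind

/-- Reflection in a horizontal line: the order of the points is reversed. -/
def mirror {L N : ℕ} (h : L = N) (M : Matching L) : Matching N where
  partner i := if i < L then L - 1 - M.partner (L - 1 - i) else i
  partner_lt i hi := by
    have := M.partner_lt (L - 1 - i)
    grind
  partner_ne i hi := by
    have := M.partner_lt (L - 1 - i)
    have := M.partner_ne (L - 1 - i)
    grind
  partner_of_ge i hi := by grind
  partner_partner i := by
    have := M.partner_lt (L - 1 - i)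
    have := M.partner_partner (L - 1 - i)
    grind
  noncrossing i j := by
    have h1 := M.partner_lt (L - 1 - i)
    have h2 := M.partner_lt (L - 1 - j)
    have h3 := M.noncrossing (M.partner (L - 1 - j)) (M.partner (L - 1 - i))
    have h4 := M.partner_partner (L - 1 - i)
    have h5 := M.partner_partner (L - 1 - j)
    grind

theorem partner_inj {N : ℕ} (M : Matching N) {i j : ℕ} (h : M.partner i = M.partner j) : i = j := by
  rw [← M.partner_partner i, h, M.partner_partner]

/-- A set of consecutive points that is closed under `partner` has an even number of elements. -/
theorem even_of_closed {N : ℕ} (M : Matching N) (d a : ℕ) (hN : a + d ≤ N)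
    (h : ∀ i, a ≤ i → i < a + d → a ≤ M.partner i ∧ M.partner i < a + d) : Even d := by
  induction d using Nat.strong_induction_on generalizing a with
  | _ d ih =>
    rcases Nat.eq_zero_or_pos d with rfl | hd
    · exact Even.zero
    have ha := h a le_rfl (by omega)
    have hne := M.partner_ne a (by omega)
    have e := M.partner_partner a
    -- The arc at the first point splits the remaining points into those under it and those beyond
    -- it; planarity makes both blocks closed.
    have h1 : Even (M.partner a - (a + 1)) := by
      refine ih _ (by omega) (a + 1) (by omega) fun i hi1 hi2 => ?_
      have n1 := M.noncrossing a i
      have n2 := h i (by omega) (by omega)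
      have n3 : M.partner i ≠ a := fun h' => by
        have := M.partner_partner i
        rw [h'] at this; omega
      have n4 : M.partner i ≠ M.partner a := fun h' => by
        have := M.partner_inj h'; omega
      omega
    have h2 : Even (a + d - (M.partner a + 1)) := by
      refine ih _ (by omega) (M.partner a + 1) (by omega) fun i hi1 hi2 => ?_
      have n1 := M.noncrossing a (M.partner i)
      have n2 := h i (by omega) (by omega)
      have n5 := M.partner_partner i
      have n3 : M.partner i ≠ a := fun h' => by
        rw [h'] at n5; omega
      have n4 : M.partner i ≠ M.partner a := fun h' => by
        have := M.partner_inj h'; omega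
      omega
    have : d = (M.partner a - (a + 1)) + (a + d - (M.partner a + 1)) + 2 := by omega
    rw [this]
    exact (h1.add h2).add even_two

theorem even_of_partner {N : ℕ} (M : Matching N) {i j : ℕ} (hj : j < N) (hij : i < j)
    (h : M.partner i = j) : Even (j - i - 1) := by
  refine M.even_of_closed _ (i + 1) (by omega) fun x hx1 hx2 => ?_
  have n1 := M.noncrossing i x
  have n2 := M.noncrossing (M.partner x) i
  have n5 := M.partner_partner x
  have n3 : M.partner x ≠ i := fun h' => by
    rw [h'] at n5; omega
  have n4 : M.partner x ≠ M.partner i := fun h' => by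
    have := M.partner_inj h'; omega
  omega

theorem insertArc_partner {N L : ℕ} (hN : L = N + 2) (p : ℕ) (hp : p ≤ N) (M : Matching N) (i) :
    (M.insertArc hN p hp).partner i = if i = p then p + 1 else if i = p + 1 then p
    else insertTwo p (M.partner (removeTwo p i)) := rfl

theorem join_partner {N L : ℕ} (hN : L = N + 2) (p : ℕ) (hp : p ≤ N) (M : Matching L) (i) :
    (M.join hN p hp).partner i = joinFun M.partner p i := rfl

theorem insertArc_join {N L : ℕ} (hN : L = N + 2) (p : ℕ) (hp : p ≤ N) (M : Matching L)
    (h : M.partner p = p + 1) : (M.join hN p hp).insertArc hN p hp = M := by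
  ext i
  have e := M.partner_partner p
  have e1 := M.partner_partner i
  rw [h] at e
  simp only [insertArc_partner, join_partner, joinFun, insertTwo, removeTwo]
  grind (splits := 25)

/-- The arc at `p + 1` and the joining arc at `p` overlap in one point and form a zigzag, which
straightens to the original strand. -/
theorem join_insertArc_succ {N L : ℕ} (hN : L = N + 2) (p : ℕ) (hp : p + 1 ≤ N) (M : Matching N) :
    (M.insertArc hN (p + 1) hp).join hN p (by omega) = M := by
  ext i
  have e := M.partner_partner p
  have e1 := M.partner_partner i
  have f := M.partner_ne p (by omega)
  simp only [insertArc_partner, join_partner, joinFun, insertTwo, removeTwo]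
  grind (splits := 25)

theorem join_insertArc {K N L : ℕ} (hN : L = N + 2) (hK : N = K + 2) (p q : ℕ) (hpq : p ≤ q)
    (hq : q ≤ K) (M : Matching N) :
    (M.insertArc hN (q + 2) (by omega)).join hN p (by omega) =
      (M.join hK p (by omega)).insertArc hK q hq := by
  ext i
  have e := M.partner_partner p
  have e2 := M.partner_partner (p + 1)
  have e1 := M.partner_partner i
  have e3 := M.partner_partner (i - 2)
  have e3 := M.partner_partner (i + 2)
  have f := M.partner_ne p (by omega)
  have f2 := M.partner_ne (p + 1) (by omega)
  simp only [insertArc_partner, join_partner, joinFun, insertTwo, removeTwo]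
  grind (splits := 25)

theorem join_join {K N L : ℕ} (hN : L = N + 2) (hK : N = K + 2) (a b : ℕ) (hab : a ≤ b)
    (hb : b ≤ K) (M : Matching L) :
    (M.join hN (b + 2) (by omega)).join hK a (by omega) =
      (M.join hN a (by omega)).join hK b hb := by
  ext i
  have e1 := M.partner_partner a
  have e2 := M.partner_partner (a + 1)
  have e3 := M.partner_partner (b + 2)
  have e4 := M.partner_partner (b + 3)
  have f1 := M.partner_ne a (by omega)
  have f2 := M.partner_ne (a + 1) (by omega)
  have f3 := M.partner_ne (b + 2) (by omega)
  have f4 := M.partner_ne (b + 3) (by omega)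
  have e5 := M.partner_partner i
  have e6 := M.partner_partner (i + 2)
  have e7 := M.partner_partner (i + 4)
  simp only [join_partner, joinFun, insertTwo, removeTwo]
  grind (splits := 25)

/-- The bound on `p` keeps the joined pair away from the point `0`, which is the one that wraps
around. -/
theorem join_rotateCCW {N L : ℕ} (hN : L = N + 2) (p : ℕ) (hp : p + 1 ≤ N) (M : Matching L) :
    M.rotateCCW.join hN p (by omega) = (M.join hN (p + 1) hp).rotateCCW := by
  ext i
  have e1 := M.partner_partner (p + 1)
  have e2 := M.partner_partner (p + 2)
  have e3 := M.partner_partner (i + 1)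
  have e4 := M.partner_partner (i + 3)
  have e5 := M.partner_partner 0
  have f1 := M.partner_ne (p + 1) (by omega)
  have f2 := M.partner_ne (p + 2) (by omega)
  have g1 := M.partner_lt (p + 1) (by omega)
  have g2 := M.partner_lt (p + 2) (by omega)
  have g3 := M.partner_lt (i + 1)
  have g4 := M.partner_lt (i + 3)
  have g5 := M.partner_lt 0 (by omega)
  simp only [join_partner, joinFun, insertTwo, removeTwo, rotateCCW, next, prev]
  grind (splits := 25)

theorem join_mirror {N L : ℕ} (hN : L = N + 2) {L' N' : ℕ} (hL : L = L') (hN' : N = N')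
    (p q : ℕ) (hp : p + q = N) (M : Matching L) :
    (M.mirror hL).join (by omega : L' = N' + 2) p (by omega) =
      (M.join hN q (by omega)).mirror hN' := by
  ext i
  have e1 := M.partner_partner q
  have e2 := M.partner_partner (q + 1)
  have e3 := M.partner_partner (L - 1 - i)
  have e4 := M.partner_partner (N - 1 - i)
  have f1 := M.partner_ne q (by omega)
  have f2 := M.partner_ne (q + 1) (by omega)
  have g1 := M.partner_lt q (by omega)
  have g2 := M.partner_lt (q + 1) (by omega)
  have g3 := M.partner_lt (L - 1 - i)
  have g4 := M.partner_lt (N - 1 - i)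
  have g5 := M.partner_of_ge i
  simp only [join_partner, joinFun, insertTwo, removeTwo, mirror]
  grind (splits := 25)

theorem mirror_partner_eq_iff {L L' : ℕ} (hL : L = L') (p q : ℕ) (hp : p + q + 2 = L)
    (M : Matching L) : (M.mirror hL).partner p = p + 1 ↔ M.partner q = q + 1 := by
  have e1 := M.partner_partner q
  have e2 := M.partner_partner (q + 1)
  have g1 := M.partner_lt q (by omega)
  have g2 := M.partner_lt (q + 1) (by omega)
  have : L - 1 - p = q + 1 := by omega
  simp only [mirror, this]
  grind (splits := 25)

theorem mirror_juxtapose {a b a' b' : ℕ} (ha : a = a') (hb : b = b') (M : Matching a) (L : Matching b) :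
    (M.juxtapose L).mirror (by omega : a + b = b' + a') = (L.mirror hb).juxtapose (M.mirror ha) := by
  ext i
  have h1 := M.partner_lt (a + b - 1 - i)
  have h2 := L.partner_lt (b - 1 - i)
  have h3 := M.partner_of_ge (a + b - 1 - i)
  simp only [juxtapose, mirror]
  grind (splits := 25)

theorem mirror_mirror {L N : ℕ} (h : L = N) (h' : N = L) (M : Matching L) : (M.mirror h).mirror h' = M := by
  ext i
  have h1 := M.partner_lt i
  have h3 := M.partner_of_ge i
  simp only [mirror]
  grind (splits := 25)

theorem mirror_id (n : ℕ) : (id n).mirror rfl = id n := by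
  ext i
  simp only [mirror, id]
  grind (splits := 25)

theorem juxtapose_insertArc {a b L : ℕ} (hL : L = b + 2) (j : ℕ) (hj : j ≤ b)
    (M : Matching a) (M' : Matching b) :
    M.juxtapose (M'.insertArc hL j hj) =
      (M.juxtapose M').insertArc (by omega) (a + j) (by omega) := by
  ext i
  have h1 := M.partner_lt i
  simp only [juxtapose, insertArc_partner, insertTwo, removeTwo]
  grind (splits := 25)

theorem join_juxtapose {a b L : ℕ} (hL : L = a + 2) (p : ℕ) (hp : p ≤ a)
    (M : Matching L) (M' : Matching b) :
    (M.juxtapose M').join (by omega : L + b = a + b + 2) p (by omega) =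
      (M.join hL p hp).juxtapose M' := by
  ext i
  have h1 := M.partner_lt i
  have h2 := M.partner_lt (i + 2)
  have h3 := M.partner_lt p (by omega)
  have h4 := M.partner_lt (p + 1) (by omega)
  simp only [juxtapose, join_partner, joinFun, insertTwo, removeTwo]
  grind (splits := 25)

theorem rotateCCW_rotateCW {N : ℕ} (M : Matching N) : M.rotateCW.rotateCCW = M := by
  ext i
  have h1 := M.partner_lt i
  have h2 := M.partner_of_ge i
  simp only [rotateCW, rotateCCW, next, prev]
  grind (splits := 25)

theorem rotateCW_rotateCCW {N : ℕ} (M : Matching N) : M.rotateCCW.rotateCW = M := by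
  ext i
  have h1 := M.partner_lt i
  have h2 := M.partner_of_ge i
  simp only [rotateCW, rotateCCW, next, prev]
  grind (splits := 25)

end Matching
end TwoColorTL

/-! ### Caps as linear maps, and gluing onto a small arc. -/

noncomputable section

namespace TwoColorTL

open Matching

namespace Matching

theorem insertArc_partner_eq_iff {N L : ℕ} (hN : L = N + 2) (p q : ℕ) (hpq : p ≤ q)
    (hq : q + 2 ≤ N) (M : Matching N) :
    (M.insertArc hN (q + 2) hq).partner p = p + 1 ↔ M.partner p = p + 1 := by
  simp only [insertArc_partner, insertTwo, removeTwo]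
  grind

theorem insertArc_succ_partner_ne {N L : ℕ} (hN : L = N + 2) (p : ℕ) (hp : p + 1 ≤ N)
    (M : Matching N) : (M.insertArc hN (p + 1) hp).partner p ≠ p + 1 := by
  simp only [insertArc_partner, insertTwo, removeTwo]
  grind

theorem rotateCCW_partner_eq_iff {N : ℕ} (p : ℕ) (hp : p + 2 < N) (M : Matching N) :
    M.rotateCCW.partner p = p + 1 ↔ M.partner (p + 1) = p + 2 := by
  have := M.partner_lt (p + 1) (by omega)
  simp only [rotateCCW, next, prev]
  grind

theorem juxtapose_partner_eq_iff {a b : ℕ} (p : ℕ) (hp : p + 1 < a) (M : Matching a)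
    (M' : Matching b) : (M.juxtapose M').partner p = p + 1 ↔ M.partner p = p + 1 := by
  simp only [juxtapose]
  grind

/-- A join elsewhere can create this arc only if both points are tied to the joined pair, and
planarity forces those two arcs to be nested. -/
theorem join_partner_left_iff {N L : ℕ} (hN : L = N + 2) (a b : ℕ) (hab : a ≤ b)
    (hb : b + 2 ≤ N) (M : Matching L) :
    (M.join hN (b + 2) (by omega)).partner a = a + 1 ↔
      M.partner a = a + 1 ∨ (M.partner a = b + 3 ∧ M.partner (a + 1) = b + 2) := by
  have e1 := M.partner_partner a
  have e2 := M.partner_partner (a + 1)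
  have e3 := M.partner_partner (b + 2)
  have e4 := M.partner_partner (b + 3)
  have f1 := M.partner_ne (b + 3) (by omega)
  have f2 := M.partner_ne (b + 2) (by omega)
  have nc := M.noncrossing a (a + 1)
  simp only [join_partner, joinFun, insertTwo, removeTwo]
  grind

theorem join_partner_right_iff {N L : ℕ} (hN : L = N + 2) (a b : ℕ) (hab : a ≤ b)
    (hb : b + 2 ≤ N) (M : Matching L) :
    (M.join hN a (by omega)).partner b = b + 1 ↔
      M.partner (b + 2) = b + 3 ∨ (M.partner a = b + 3 ∧ M.partner (a + 1) = b + 2) := by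
  have e1 := M.partner_partner a
  have e2 := M.partner_partner (a + 1)
  have e3 := M.partner_partner (b + 2)
  have e4 := M.partner_partner (b + 3)
  have nc := M.noncrossing a (a + 1)
  simp only [join_partner, joinFun, insertTwo, removeTwo]
  grind

end Matching

section

variable {𝕜 : Type*} [CommRing 𝕜] [Algebra A 𝕜]

theorem capOff_single {L N : ℕ} (hN : L = N + 2) (p : ℕ) (hp : p ≤ N) (u : Color)
    (M : Matching L) (a : 𝕜) : capOff hN p hp u (Finsupp.single M a) =
      Finsupp.single (M.join hN p hp)
        (a * if M.partner p = p + 1 then circleValue 𝕜 u else 1) := by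
  simp [capOff]

theorem capOff_single_one {L N : ℕ} (hN : L = N + 2) (p : ℕ) (hp : p ≤ N) (u : Color)
    (M : Matching L) : capOff hN p hp u (Finsupp.single M (1 : 𝕜)) =
      Finsupp.single (M.join hN p hp)
        (if M.partner p = p + 1 then circleValue 𝕜 u else 1) := by
  simp [capOff]

/-- The order matters only when two nested arcs link the pairs: one circle arises, evaluated with
the color of whichever cap comes last. The inner arc then encloses `b - a` points, an even number,
and only in that case must the colors agree. -/
theorem capOff_comm {K N N' L : ℕ} (hN : L = N + 2) (hK : N = K + 2) (hN' : N' = N) (a b : ℕ) (hab : a ≤ b)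
    (hb : b ≤ K) (u w : Color) (huw : Even (b - a) → u = w) (v : Matching L →₀ 𝕜) :
    capOff hK a (by omega) u (capOff hN (b + 2) (by omega) w v) =
      capOff (hN'.trans hK) b hb w (capOff (by omega) a (by omega) u v) := by
  subst hN'
  rw [← LinearMap.comp_apply, ← LinearMap.comp_apply]
  congr 1
  refine Finsupp.lhom_ext' fun M => LinearMap.ext_ring ?_
  simp only [LinearMap.comp_apply, Finsupp.lsingle_apply, capOff_single]
  rw [join_join hN hK a b hab hb]
  congr 1
  simp only [join_partner_left_iff hN a b hab (by omega), join_partner_right_iff hN a b hab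
    (by omega)]
  by_cases h : M.partner a = b + 3 ∧ M.partner (a + 1) = b + 2
  · have h1 : Even (b - a) := by
      have := M.even_of_partner (i := a + 1) (j := b + 2) (by omega) (by omega) h.2
      rwa [show b + 2 - (a + 1) - 1 = b - a by omega] at this
    have h2 : M.partner a ≠ a + 1 := by omega
    have h3 : M.partner (b + 2) ≠ b + 3 := by
      have := M.partner_partner (a + 1)
      rw [h.2] at this; omega
    simp [h2, h3, huw h1]
  · simp only [h, or_false]
    ring

theorem capOff_insertArc_succ {N L : ℕ} (hN : L = N + 2) (p q : ℕ) (hpq : q = p + 1) (hq : q ≤ N)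
    (u : Color) (v : Matching N →₀ 𝕜) :
    capOff hN p (by omega) u (Finsupp.lmapDomain 𝕜 𝕜 (insertArc hN q hq) v) = v := by
  subst hpq
  rw [← LinearMap.comp_apply]
  conv_rhs => rw [← LinearMap.id_apply (R := 𝕜) v]
  congr 1
  refine Finsupp.lhom_ext' fun M => LinearMap.ext_ring ?_
  simp [capOff_single, insertArc_succ_partner_ne, join_insertArc_succ]

/-- The equal sizes `N` and `N'` are kept apart because in `glue_insertArc` they are different
expressions, equal only propositionally. -/
theorem capOff_capOff_insertArc {K N N' L : ℕ} (hN : L = N + 2) (hK : N = K + 2) (hN' : N' = N)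
    (r p q : ℕ) (hr : r ≤ K) (hpq : q = p + 1) (hq : q ≤ N) (u w : Color) (v : Matching N' →₀ 𝕜) :
    capOff hK r hr w (capOff hN p (by omega) u
      (Finsupp.lmapDomain 𝕜 𝕜 (insertArc (by omega) q (by omega)) v)) =
      capOff (hN'.trans hK) r hr w v := by
  subst hN'
  rw [capOff_insertArc_succ hN p q hpq hq]

theorem capOff_insertArc {K N N' L : ℕ} (hN : L = N + 2) (hK : N = K + 2) (hN' : N' = N) (p q r : ℕ) (hpq : p ≤ q)
    (hq : q ≤ K) (hr : r = q + 2) (u : Color) (v : Matching N' →₀ 𝕜) :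
    capOff hN p (by omega) u (Finsupp.lmapDomain 𝕜 𝕜 (insertArc (by omega) r (by omega)) v) =
      Finsupp.lmapDomain 𝕜 𝕜 (insertArc hK q hq) (capOff (by omega) p (by omega) u v) := by
  subst hN'
  subst hr
  rw [← LinearMap.comp_apply, ← LinearMap.comp_apply]
  congr 1
  refine Finsupp.lhom_ext' fun M => LinearMap.ext_ring ?_
  simp [capOff_single, insertArc_partner_eq_iff hN p q hpq (by omega : q + 2 ≤ N') M,
    join_insertArc hN hK p q hpq hq]

theorem capOff_rotateCCW {N L : ℕ} (hN : L = N + 2) (p : ℕ) (hp : p + 1 ≤ N) (u : Color)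
    (v : Matching L →₀ 𝕜) :
    capOff hN p (by omega) u (Finsupp.lmapDomain 𝕜 𝕜 rotateCCW v) =
      Finsupp.lmapDomain 𝕜 𝕜 rotateCCW (capOff hN (p + 1) hp u v) := by
  rw [← LinearMap.comp_apply, ← LinearMap.comp_apply]
  congr 1
  refine Finsupp.lhom_ext' fun M => LinearMap.ext_ring ?_
  simp [capOff_single, rotateCCW_partner_eq_iff p (by omega : p + 2 < L),
    join_rotateCCW hN p hp]

theorem capOff_mirror {N L : ℕ} (hN : L = N + 2) {L' N' : ℕ} (hL : L = L') (hN' : N = N')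
    (p q : ℕ) (hp : p + q = N) (u : Color) (v : Matching L →₀ 𝕜) :
    capOff (by omega : L' = N' + 2) p (by omega) u (Finsupp.lmapDomain 𝕜 𝕜 (mirror hL) v) =
      Finsupp.lmapDomain 𝕜 𝕜 (mirror hN') (capOff hN q (by omega) u v) := by
  rw [← LinearMap.comp_apply, ← LinearMap.comp_apply]
  congr 1
  refine Finsupp.lhom_ext' fun M => LinearMap.ext_ring ?_
  simp [capOff_single, mirror_partner_eq_iff hL p q (by omega),
    join_mirror hN hL hN' p q hp]

theorem Color.swap_swap (c : Color) : c.swap.swap = c := by cases c <;> rfl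

theorem Color.swap_iterate_add_even (c : Color) (a b : ℕ) (hb : Even b) :
    Color.swap^[a + b] c = Color.swap^[a] c := by
  obtain ⟨d, rfl⟩ := hb
  have : Function.Involutive Color.swap := Color.swap_swap
  rw [Function.iterate_add_apply, this.iterate_even ⟨d, rfl⟩]
  rfl

theorem Color.swap_iterate_congr (c : Color) {a b : ℕ} (h : Even (a + b)) :
    Color.swap^[a] c = Color.swap^[b] c := by
  rw [← Color.swap_iterate_add_even c a (a + b) h,
    ← Color.swap_iterate_add_even c b (a + a) ⟨a, rfl⟩]
  congr 1
  omega

/-- Reflection exchanges the two diagrams but keeps left and right, so the strands are glued in the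
same order with the same colors. -/
theorem glue_mirror (c : Color) (k n m : ℕ) (v : Matching ((k + m) + (m + n)) →₀ 𝕜) :
    glue c n k m (Finsupp.lmapDomain 𝕜 𝕜 (mirror (by omega)) v) =
      Finsupp.lmapDomain 𝕜 𝕜 (mirror (by omega)) (glue c k n m v) := by
  induction m with
  | zero =>
    simp only [glue]
    rw [← LinearMap.comp_apply, ← LinearMap.comp_apply]
    congr 1
    refine Finsupp.lhom_ext' fun M => LinearMap.ext_ring ?_
    simp only [LinearMap.comp_apply, Finsupp.lsingle_apply, Finsupp.lmapDomain_apply,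
      Finsupp.mapDomain_single]
    congr 1
    ext i
    simp [mirror, Matching.cast]
  | succ m ih =>
    simp only [glue, LinearMap.comp_apply]
    rw [capOff_mirror (N := (k + m) + (m + n)) (N' := (n + m) + (m + k)) (by omega) _ (by omega)
      (n + m) (k + m) (by omega), ih]

theorem glue_succ (c : Color) (k n m : ℕ) (v : Matching ((k + (m + 1)) + ((m + 1) + n)) →₀ 𝕜) :
    glue c k n (m + 1) v =
      glue c k n m (capOff (by omega) (k + m) (by omega) (Color.swap^[m] c) v) := rfl

/-- An arc at the top of the lower diagram caps off two bottom points of the upper diagram. -/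
theorem glue_insertArc (c : Color) (k n m j p : ℕ) (hj : j ≤ m) (hp : p + j = k + m)
    (v : Matching ((k + (m + 2)) + (m + n)) →₀ 𝕜) :
    glue c k n (m + 2) (Finsupp.lmapDomain 𝕜 𝕜
        (insertArc (by omega) (k + (m + 2) + j) (by omega)) v) =
      glue c k n m (capOff (by omega) p (by omega) (Color.swap^[m + j] c) v) := by
  induction j generalizing m with
  | zero =>
    obtain rfl : p = k + m := hp
    -- The arc sits on the two leftmost strands: gluing the first straightens a zigzag, and gluing
    -- the second is the required cap.
    exact congrArg (glue c k n m) (capOff_capOff_insertArc (𝕜 := 𝕜)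
      (N := k + (m + 1) + (m + 1 + n)) (L := k + (m + 2) + (m + 2 + n)) (by omega) (by omega)
      (by omega) (k + m) (k + (m + 1)) (k + (m + 2) + 0) (by omega) (by omega) (by omega)
      (Color.swap^[m + 1] c) (Color.swap^[m] c) v)
  | succ j ih =>
    obtain ⟨m, rfl⟩ : ∃ m', m = m' + 1 := ⟨m - 1, by omega⟩
    -- The leftmost strand avoids the arc. `h1` moves its gluing past the arc, `ih` turns the arc
    -- into a cap, and `h2` interchanges the two caps.
    have h1 := capOff_insertArc (𝕜 := 𝕜) (K := k + (m + 2) + (m + n))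
      (N := k + (m + 2) + (m + 2 + n)) (L := k + (m + 1 + 2) + (m + 1 + 2 + n)) (by omega)
      (by omega) (by omega) (k + (m + 2)) (k + (m + 2) + j) (k + (m + 1 + 2) + (j + 1)) (by omega) (by omega)
      (by omega) (Color.swap^[m + 2] c) v
    have h2 := capOff_comm (𝕜 := 𝕜) (K := k + m + (m + n)) (N := k + (m + 2) + (m + n))
      (N' := k + (m + 1) + (m + 1 + n)) (L := k + (m + 1 + 2) + (m + 1 + n))
      (by omega) (by omega) (by omega)
      p (k + m) (by omega) (by omega) (Color.swap^[m + j] c) (Color.swap^[m] c)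
      (fun h => Color.swap_iterate_add_even c m j (by
        rwa [show k + m - p = j by omega] at h)) v
    rw [glue_succ c k n m]
    refine (congrArg (glue c k n (m + 2)) h1).trans ((ih m (by omega) (by omega) _).trans ?_)
    refine congrArg (glue c k n m) ?_
    rw [Color.swap_iterate_add_even c m 2 even_two]
    rw [← Color.swap_iterate_congr c (a := m + j) (b := m + 1 + (j + 1)) ⟨m + j + 1, by omega⟩]
    exact h2


end
end TwoColorTL

/-! ### Composition with a diagram that has a top arc. -/

noncomputable section

namespace TwoColorTL

open Matching

namespace Matching

/-- Descent to an innermost arc: if the arc at `i` is not small, the arc at `i + 1` lies strictly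
under it. -/
theorem exists_arc_of_partner_lt {N : ℕ} (M : Matching N) {n i : ℕ} (hn : n ≤ N)
    (hi : i < M.partner i) (h : M.partner i < n) :
    ∃ j, j + 1 < n ∧ M.partner j = j + 1 := by
  induction hd : M.partner i - i using Nat.strong_induction_on generalizing i with
  | _ d ih =>
    by_cases h1 : M.partner i = i + 1
    · exact ⟨i, by omega, h1⟩
    have n1 := M.noncrossing i (i + 1)
    have n2 := M.noncrossing (M.partner (i + 1)) i
    have e1 := M.partner_partner (i + 1)
    have e := M.partner_partner i
    have f := M.partner_ne (i + 1) (by omega)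
    have g : M.partner (i + 1) ≠ i := fun h' => by rw [h'] at e1; omega
    have g2 : M.partner (i + 1) ≠ M.partner i := fun h' => by
      have := M.partner_inj h'; omega
    exact ih _ (by omega) (i := i + 1) (by omega) (by omega) rfl

/-- A matching other than the identity joins two neighbouring top points. -/
theorem exists_top_arc {n : ℕ} (M : Matching (n + n)) (hM : M ≠ id n) :
    ∃ j, j + 1 < n ∧ M.partner j = j + 1 := by
  -- Without small top arcs every top point goes to the bottom, and planarity makes `partner`
  -- strictly decreasing there. A strictly decreasing map from n points to n values is the reversal;
  -- `h3` and `h4` are the two bounds.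
  by_contra hno
  apply hM
  have h1 : ∀ i, i < n → n ≤ M.partner i := by
    intro i hi
    by_contra hlt
    have hne := M.partner_ne i (by omega)
    have e := M.partner_partner i
    rcases lt_or_gt_of_ne hne with h | h
    · exact hno (M.exists_arc_of_partner_lt (i := M.partner i) (n := n) (by omega)
        (by rw [e]; exact h) (by rw [e]; exact hi))
    · exact hno (M.exists_arc_of_partner_lt (by omega) h (by omega))
  have h2 : ∀ i, i + 1 < n → M.partner (i + 1) < M.partner i := by
    intro i hi
    have n1 := M.noncrossing i (i + 1)
    have k1 := h1 i (by omega)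
    have g2 : M.partner (i + 1) ≠ M.partner i := fun h' => by
      have := M.partner_inj h'; omega
    omega
  have h3 : ∀ i, i < n → M.partner i ≤ n + n - 1 - i := by
    intro i
    induction i with
    | zero => intro hi; have := M.partner_lt 0 (by omega); omega
    | succ i ih => intro hi; have := h2 i hi; have := ih (by omega); omega
  have h4 : ∀ d i, i + d + 1 = n → n + d ≤ M.partner i := by
    intro d
    induction d with
    | zero => intro i hi; exact h1 i (by omega)
    | succ d ih => intro i hi; have := h2 i (by omega); have := ih (i + 1) (by omega); omega
  have h5 : ∀ i, i < n → M.partner i = n + n - 1 - i := by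
    intro i hi
    have := h3 i hi
    have := h4 (n - 1 - i) i (by omega)
    omega
  ext i
  simp only [id]
  rcases lt_or_ge i n with hi | hi
  · rw [h5 i hi, if_pos (by omega)]
  rcases lt_or_ge i (n + n) with hi' | hi'
  · have := h5 (n + n - 1 - i) (by omega)
    have e := M.partner_partner (n + n - 1 - i)
    rw [this, show n + n - 1 - (n + n - 1 - i) = i by omega] at e
    rw [e, if_pos hi']
  · rw [M.partner_of_ge i hi', if_neg (by omega)]

end Matching

section

variable {𝕜 : Type*} [CommRing 𝕜] [Algebra A 𝕜]

/-- Bilinear extension of `Matching.juxtapose`. -/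
def juxt (a b : ℕ) : (Matching a →₀ 𝕜) →ₗ[𝕜] (Matching b →₀ 𝕜) →ₗ[𝕜] (Matching (a + b) →₀ 𝕜) :=
  Finsupp.linearCombination 𝕜 fun β => Finsupp.lmapDomain 𝕜 𝕜 β.juxtapose

theorem juxt_single {a b : ℕ} (β : Matching a) (α : Matching b) (x y : 𝕜) :
    juxt a b (Finsupp.single β x) (Finsupp.single α y) =
      Finsupp.single (β.juxtapose α) (x * y) := by
  simp [juxt]

theorem comp_eq (c : Color) {n m k : ℕ} (f : Hom 𝕜 c m k) (g : Hom 𝕜 c n m) :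
    comp c f g = glue c k n m (juxt _ _ f g) := by
  unfold comp juxt
  congr 1
  rw [Finsupp.linearCombination_apply]
  simp only [Finsupp.sum, LinearMap.sum_apply, LinearMap.smul_apply, Finsupp.lmapDomain_apply,
    Finsupp.mapDomain, Finset.smul_sum, Finsupp.smul_single, smul_eq_mul]

theorem juxt_mirror {a b a' b' : ℕ} (ha : a = a') (hb : b = b') (f : Matching a →₀ 𝕜)
    (g : Matching b →₀ 𝕜) :
    juxt b' a' (Finsupp.lmapDomain 𝕜 𝕜 (mirror hb) g) (Finsupp.lmapDomain 𝕜 𝕜 (mirror ha) f) =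
      Finsupp.lmapDomain 𝕜 𝕜 (mirror (by omega)) (juxt a b f g) := by
  induction f using Finsupp.induction_linear with
  | zero => simp
  | add f₁ f₂ h₁ h₂ => simp only [map_add, LinearMap.add_apply, h₁, h₂]
  | single β x =>
    induction g using Finsupp.induction_linear with
    | zero => simp
    | add f₁ f₂ h₁ h₂ => simp only [map_add, LinearMap.add_apply, h₁, h₂]
    | single α y =>
      simp only [juxt_single, Finsupp.lmapDomain_apply, Finsupp.mapDomain_single,
        mirror_juxtapose ha hb, mul_comm x y]

/-- Reflection reverses composition, which transfers statements about bottom caps to top caps. -/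
theorem comp_mirror (c : Color) {n m k : ℕ} (f : Hom 𝕜 c m k) (g : Hom 𝕜 c n m) :
    comp c (Finsupp.lmapDomain 𝕜 𝕜 (mirror (add_comm m n)) g : Hom 𝕜 c m n)
      (Finsupp.lmapDomain 𝕜 𝕜 (mirror (add_comm k m)) f : Hom 𝕜 c k m) =
      Finsupp.lmapDomain 𝕜 𝕜 (mirror (add_comm k n)) (comp c f g) := by
  rw [comp_eq, comp_eq, juxt_mirror, glue_mirror]

theorem juxt_insertArc {a b L : ℕ} (hL : L = b + 2) (j : ℕ) (hj : j ≤ b)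
    (v : Matching a →₀ 𝕜) (M' : Matching b) :
    juxt a L v (Finsupp.single (M'.insertArc hL j hj) 1) =
      Finsupp.lmapDomain 𝕜 𝕜 (insertArc (by omega) (a + j) (by omega))
        (juxt a b v (Finsupp.single M' 1)) := by
  induction v using Finsupp.induction_linear with
  | zero => simp
  | add f₁ f₂ h₁ h₂ => simp only [map_add, LinearMap.add_apply, h₁, h₂]
  | single β x =>
    simp only [juxt_single, Finsupp.lmapDomain_apply, Finsupp.mapDomain_single,
      juxtapose_insertArc]

theorem capOff_juxt {a b L : ℕ} (hL : L = a + 2) (p : ℕ) (hp : p ≤ a) (u : Color)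
    (v : Matching L →₀ 𝕜) (M' : Matching b) :
    capOff (by omega : L + b = a + b + 2) p (by omega) u (juxt L b v (Finsupp.single M' 1)) =
      juxt a b (capOff hL p hp u v) (Finsupp.single M' 1) := by
  induction v using Finsupp.induction_linear with
  | zero => simp
  | add f₁ f₂ h₁ h₂ => simp only [map_add, LinearMap.add_apply, h₁, h₂]
  | single β x =>
    simp only [juxt_single, capOff_single, join_juxtapose hL p hp, mul_one,
      juxtapose_partner_eq_iff p (by omega : p + 1 < L)]

/-- The cup is absorbed into the upper factor. Bottom points are numbered from right to left, hence
`p + j = k + m`. -/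
theorem comp_insertArc (c : Color) {n m k : ℕ} (j p : ℕ) (hj : j ≤ m) (hp : p + j = k + m)
    (f : Hom 𝕜 c (m + 2) k) (M' : Matching (m + n)) :
    comp c f (Finsupp.single (M'.insertArc (by omega) j (by omega)) 1 : Hom 𝕜 c n (m + 2)) =
      comp c (capOff (by omega) p (by omega) (Color.swap^[m + j] c) f : Hom 𝕜 c m k)
        (Finsupp.single M' 1) := by
  rw [comp_eq, comp_eq, juxt_insertArc, glue_insertArc c k n m j p hj hp, capOff_juxt]

/-- `Z` is `β` with a nest of `m` arcs inserted before the point `k + m`. Gluing one strand replaces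
a point of `β` by the far end of the outermost arc, without a circle, and leaves a smaller nest. For
`m = n` this is `β` on top of the identity; the general form covers the intermediate stages. -/
theorem glue_nested (c : Color) (k n m : ℕ) (β : Matching (k + n)) (hm : m ≤ n)
    (Z : Matching ((k + m) + (m + n)))
    (hZ : ∀ i, Z.partner i = if k + m ≤ i ∧ i < k + 3 * m then 2 * k + 4 * m - 1 - i
      else
        (fun x => if x < k + m then x else x + 2 * m)
          (β.partner (if i < k + m then i else i - 2 * m))) :
    glue c k n m (Finsupp.single Z (1 : 𝕜)) = Finsupp.single β 1 := by
  induction m with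
  | zero =>
    simp only [glue, Finsupp.lmapDomain_apply, Finsupp.mapDomain_single]
    congr 1
    ext i
    have := hZ i
    simp only [Matching.cast]
    grind
  | succ m ih =>
    rw [glue_succ, capOff_single_one, if_neg]
    · refine ih (by omega) _ fun i => ?_
      have e1 := β.partner_partner i
      have e2 := β.partner_partner (k + m)
      have e3 := β.partner_partner (i - 2 * m)
      have f1 := β.partner_ne (k + m) (by omega)
      have z1 := hZ (k + m)
      have z2 := hZ (k + m + 1)
      have z3 := hZ i
      have z4 := hZ (i + 2)
      simp only [join_partner, joinFun, insertTwo, removeTwo]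
      grind (splits := 25)
    · have := hZ (k + m)
      have f := β.partner_ne (k + m) (by omega)
      grind

theorem comp_one (c : Color) {n k : ℕ} (f : Hom 𝕜 c n k) : comp c f (one 𝕜 c n) = f := by
  rw [comp_eq]
  induction f using Finsupp.induction_linear with
  | zero => simp
  | add f₁ f₂ h₁ h₂ => simp only [map_add, LinearMap.add_apply, h₁, h₂]
  | single β x =>
    have h := glue_nested (𝕜 := 𝕜) c k n n β le_rfl (β.juxtapose (Matching.id n)) (fun i => by
      have e1 := β.partner_lt i
      have e2 := β.partner_of_ge (i - 2 * n)
      simp only [juxtapose, Matching.id]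
      grind (splits := 25))
    rw [one, juxt_single, mul_one, ← mul_one x, ← smul_eq_mul, ← Finsupp.smul_single, map_smul, h,
      Finsupp.smul_single]

end
end TwoColorTL

/-! ### Hooks, and uniqueness of elements killed by caps. -/

noncomputable section

namespace TwoColorTL

open Matching

namespace Matching

theorem join_insertArc_pred {N L : ℕ} (hN : L = N + 2) (p : ℕ) (hp : p + 1 ≤ N) (M : Matching N) :
    (M.insertArc hN p (by omega)).join hN (p + 1) hp = M := by
  ext i
  have e := M.partner_partner p
  have e1 := M.partner_partner i
  have f := M.partner_ne p (by omega)
  simp only [insertArc_partner, join_partner, joinFun, insertTwo, removeTwo]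
  grind (splits := 25)

theorem join_insertArc_self {N L : ℕ} (hN : L = N + 2) (p : ℕ) (hp : p ≤ N) (M : Matching N) :
    (M.insertArc hN p hp).join hN p hp = M := by
  ext i
  have e1 := M.partner_partner i
  simp only [insertArc_partner, join_partner, joinFun, insertTwo, removeTwo]
  grind (splits := 25)

/-- The identity of `m` strands with a small arc inserted just before the point `min p (2 * m)`. -/
def hook (m p : ℕ) : Matching (m + 1 + (m + 1)) :=
  (id m).insertArc (by omega) (min p (m + m)) (min_le_right _ _)

theorem hook_partner {m p : ℕ} (hp : p ≤ m + m) (i : ℕ) :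
    (hook m p).partner i = if i = p then p + 1 else if i = p + 1 then p
      else insertTwo p ((id m).partner (removeTwo p i)) := by
  simp only [hook, insertArc_partner, min_eq_left hp]

theorem hook_eq {m p : ℕ} (hp : p ≤ m + m) : hook m p = (id m).insertArc (by omega) p hp := by
  ext i
  rw [hook_partner hp, insertArc_partner]

/-- An arc inserted between the last top and the first bottom point is a new rightmost strand. -/
theorem hook_self (m : ℕ) : hook m m = id (m + 1) := by
  ext i
  simp only [hook_partner (Nat.le_add_left m m), id, insertTwo, removeTwo]
  grind

theorem hook_zero (m : ℕ) : hook m 0 = (id (m + 1)).rotateCW := by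
  ext i
  simp only [hook_partner (Nat.zero_le _), id, insertTwo, removeTwo, rotateCW, next, prev]
  grind (splits := 25)

theorem join_hook {m p : ℕ} (hp : p ≤ m) :
    (hook m p).join (N := m + m) (by omega) p (by omega) = id m := by
  rw [hook_eq (by omega), join_insertArc_self]

theorem join_hook_succ {m p : ℕ} (hp : p < m) :
    (hook m (p + 1)).join (N := m + m) (by omega) p (by omega) = id m := by
  rw [hook_eq (by omega), join_insertArc_succ]

theorem join_hook_pred {m p : ℕ} (hp : p + 1 ≤ m) :
    (hook m p).join (N := m + m) (by omega) (p + 1) (by omega) = id m := by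
  rw [hook_eq (by omega), join_insertArc_pred]

theorem join_partner_insertTwo_cases {N L : ℕ} (hN : L = N + 2) {p : ℕ} (hp : p ≤ N)
    (M : Matching L) {X : Matching N} (h : M.join hN p hp = X) (i : ℕ) :
    (M.partner (insertTwo p i) = p ∧ insertTwo p (X.partner i) = M.partner (p + 1)) ∨
    (M.partner (insertTwo p i) = p + 1 ∧ insertTwo p (X.partner i) = M.partner p) ∨
    (M.partner (insertTwo p i) ≠ p ∧ M.partner (insertTwo p i) ≠ p + 1 ∧
      insertTwo p (X.partner i) = M.partner (insertTwo p i)) := by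
  subst h
  have := M.joinFun_spec p i (by omega)
  simp only [join_partner]
  tauto

/-- If none of these arcs were small, points enclosed by the arc at `p` or `p + 1` would survive as
an arc between two top points of the identity, which has none. -/
theorem arc_of_join_eq_id {m p : ℕ} (hp : p ≤ m) (M : Matching (m + 1 + (m + 1)))
    (h : M.join (N := m + m) (by omega) p (by omega) = id m) :
    M.partner p = p + 1 ∨ (0 < p ∧ M.partner (p - 1) = p) ∨
      (p < m ∧ M.partner (p + 1) = p + 2) := by
  have hM := M.join_partner_insertTwo_cases (N := m + m) (by omega) (by omega : p ≤ m + m) h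
  have a1 := M.partner_partner p
  have b1 := M.partner_partner (p + 1)
  have a2 := M.partner_lt p (by omega)
  have a3 := M.partner_ne p (by omega)
  have b2 := M.partner_lt (p + 1) (by omega)
  have b3 := M.partner_ne (p + 1) (by omega)
  by_cases h0 : M.partner p = p + 1
  · exact Or.inl h0
  right
  have h1 := hM (removeTwo p (M.partner p))
  have e1 : insertTwo p (removeTwo p (M.partner p)) = M.partner p := by
    unfold insertTwo removeTwo; grind
  rw [e1, a1] at h1
  rcases lt_or_gt_of_ne a3 with hlt | hgt
  · left
    refine ⟨by omega, ?_⟩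
    by_cases hpa : M.partner p + 1 = p
    · rw [← hpa, Nat.add_sub_cancel, a1, hpa]
    exfalso
    have h2 := hM (M.partner p + 1)
    have n1 := M.noncrossing (M.partner p) (M.partner p + 1)
    rw [a1] at n1
    simp only [id, insertTwo, removeTwo] at h1 h2
    grind
  · right
    have n1 := M.noncrossing p (p + 1)
    have n2 := M.noncrossing (M.partner (p + 1)) p
    have h2 := hM p
    have n3 := M.noncrossing (p + 1) (p + 2)
    simp only [id, insertTwo, removeTwo] at h1 h2
    grind

theorem eq_hook_of_join {m p : ℕ} (hp : p ≤ m) (M : Matching (m + 1 + (m + 1)))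
    (h : M.join (N := m + m) (by omega) p (by omega) = id m) :
    M = hook m p ∨ (0 < p ∧ M = hook m (p - 1)) ∨ (p < m ∧ M = hook m (p + 1)) := by
  rcases M.arc_of_join_eq_id hp h with h0 | ⟨hp0, h0⟩ | ⟨hpm, h0⟩
  · left
    rw [hook_eq (by omega), ← h, insertArc_join _ _ _ _ h0]
  · right; left
    obtain ⟨q, rfl⟩ : ∃ q, p = q + 1 := ⟨p - 1, by omega⟩
    refine ⟨hp0, ?_⟩
    simp only [Nat.add_sub_cancel] at h0 ⊢
    have e := insertArc_join (N := m + m) (by omega) q (by omega) M h0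
    have e2 := join_insertArc_pred (N := m + m) (L := m + 1 + (m + 1)) (by omega) q (by omega)
      (M.join (by omega) q (by omega))
    rw [e, h] at e2
    rw [hook_eq (by omega), e2, e]
  · right; right
    refine ⟨hpm, ?_⟩
    have e := insertArc_join (N := m + m) (by omega) (p + 1) (by omega) M h0
    have e2 := join_insertArc_succ (N := m + m) (L := m + 1 + (m + 1)) (by omega) p (by omega)
      (M.join (by omega) (p + 1) (by omega))
    rw [e, h] at e2
    rw [hook_eq (by omega), e2, e]

end Matching

/-- This is the discrete Wronskian of the recursion: a step of the recursion preserves it up to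
exchanging the colors. -/
theorem qnum_mul_sub (m : ℕ) (c : Color) :
    qnum (m + 1) c * qnum (m + 1) c.swap - qnum (m + 2) c * qnum m c.swap = 1 := by
  induction m generalizing c with
  | zero => simp [qnum]
  | succ m ih =>
    have h := ih c.swap
    rw [Color.swap_swap] at h
    have e1 : qnum (m + 1 + 2) c = qnum (m + 2) c.swap * MvPolynomial.X c - qnum (m + 1) c := rfl
    have e2 : qnum (m + 1 + 1) c = qnum (m + 1) c.swap * MvPolynomial.X c - qnum m c := rfl
    rw [show m + 1 + 1 = m + 2 from rfl] at *
    rw [e1]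
    linear_combination h + qnum (m + 2) c.swap * e2

section

variable {𝕜 : Type*} [CommRing 𝕜] [Algebra A 𝕜]

/-- `v` is annihilated by every cap on two neighbouring bottom points. -/
def BotKilled (c : Color) {n : ℕ} (v : Hom 𝕜 c n n) : Prop :=
  ∀ (N : ℕ) (hN : n + n = N + 2) (p : ℕ) (hp : p ≤ N), n ≤ p →
    -- The far right region lies just before the point `n`; the region before `p` is |n - p| points
    -- away, and n + p has the same parity.
    capOff hN p hp (Color.swap^[n + p] c) v = 0

/-- `v` is annihilated by every cap on two neighbouring top points. -/
def TopKilled (c : Color) {n : ℕ} (v : Hom 𝕜 c n n) : Prop :=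
  ∀ (N : ℕ) (hN : n + n = N + 2) (p : ℕ) (hp : p ≤ N), p + 2 ≤ n →
    capOff hN p hp (Color.swap^[n + p] c) v = 0

/-- The linear map induced by `Matching.mirror`. -/
def mirrorMap (𝕜 : Type*) [CommRing 𝕜] (n : ℕ) :
    (Matching (n + n) →₀ 𝕜) →ₗ[𝕜] (Matching (n + n) →₀ 𝕜) :=
  Finsupp.lmapDomain 𝕜 𝕜 (mirror rfl)

theorem mirrorMap_mirrorMap {n : ℕ} (v : Matching (n + n) →₀ 𝕜) :
    mirrorMap 𝕜 n (mirrorMap 𝕜 n v) = v := by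
  simp only [mirrorMap, Finsupp.lmapDomain_apply]
  rw [← Finsupp.mapDomain_comp]
  convert Finsupp.mapDomain_id
  ext M : 1
  exact mirror_mirror rfl rfl M

theorem mirrorMap_apply_id {n : ℕ} (v : Matching (n + n) →₀ 𝕜) :
    mirrorMap 𝕜 n v (Matching.id n) = v (Matching.id n) := by
  have : Function.Injective (mirror (rfl : n + n = n + n)) :=
    Function.LeftInverse.injective (g := mirror rfl) (mirror_mirror rfl rfl)
  conv_lhs => rw [← mirror_id n]
  exact Finsupp.mapDomain_apply this _ _

theorem BotKilled.mirrorMap {c : Color} {n : ℕ} {v : Hom 𝕜 c n n} (h : BotKilled c v) :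
    TopKilled c (mirrorMap 𝕜 n v : Hom 𝕜 c n n) := by
  intro N hN p hp hpn
  have := capOff_mirror (𝕜 := 𝕜) hN rfl rfl p (N - p) (by omega) (Color.swap^[n + p] c) v
  refine this.trans ?_
  rw [Color.swap_iterate_congr c (a := n + p) (b := n + (N - p)) ⟨n + (N - p) + p - (n - 1), by omega⟩,
    h N hN _ _ (by omega), map_zero]

theorem TopKilled.mirrorMap {c : Color} {n : ℕ} {v : Hom 𝕜 c n n} (h : TopKilled c v) :
    BotKilled c (mirrorMap 𝕜 n v : Hom 𝕜 c n n) := by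
  intro N hN p hp hpn
  have := capOff_mirror (𝕜 := 𝕜) hN rfl rfl p (N - p) (by omega) (Color.swap^[n + p] c) v
  refine this.trans ?_
  rw [Color.swap_iterate_congr c (a := n + p) (b := n + (N - p)) ⟨n + (N - p) + p - (n - 1), by omega⟩,
    h N hN _ _ (by omega), map_zero]

theorem BotKilled.comp_single {c : Color} {n : ℕ} {v : Hom 𝕜 c n n} (h : BotKilled c v)
    {M : Matching (n + n)} (hM : M ≠ Matching.id n) :
    comp c v (Finsupp.single M 1 : Hom 𝕜 c n n) = 0 := by
  obtain ⟨j, hj, hMj⟩ := M.exists_top_arc hM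
  obtain ⟨m, rfl⟩ : ∃ m, n = m + 2 := ⟨n - 2, by omega⟩
  rw [← insertArc_join (N := m + (m + 2)) (by omega) j (by omega) M hMj,
    comp_insertArc c j (m + 2 + m - j) (by omega) (by omega),
    Color.swap_iterate_congr c (b := (m + 2) + (m + 2 + m - j)) ⟨m + m + 2, by omega⟩,
    h (m + 2 + m) (by omega) _ _ (by omega), comp_eq]
  simp

theorem BotKilled.comp_eq_smul {c : Color} {n : ℕ} {v : Hom 𝕜 c n n} (h : BotKilled c v)
    (g : Hom 𝕜 c n n) : comp c v g = g (Matching.id n) • v := by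
  induction g using Finsupp.induction_linear with
  | zero => simp [comp_eq]
  | add f₁ f₂ h₁ h₂ =>
    rw [comp_eq] at *
    rw [map_add, map_add, h₁, h₂, Finsupp.add_apply, add_smul]
  | single M x =>
    have e : comp c v (Finsupp.single M x) = x • comp c v (Finsupp.single M 1 : Hom 𝕜 c n n) := by
      rw [comp_eq, comp_eq, ← map_smul, ← map_smul, Finsupp.smul_single, smul_eq_mul, mul_one]
    rw [e]
    by_cases hM : M = Matching.id n
    · subst hM
      have := comp_one c v
      rw [one] at this
      rw [this, Finsupp.single_eq_same]
    · rw [h.comp_single hM, smul_zero, Finsupp.single_eq_of_ne (Ne.symm hM), zero_smul]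

/-- Both sides equal v ∘ z: directly only the identity term of `z` survives, and after reflection
only that of `v`. -/
theorem BotKilled.smul_eq_smul {c : Color} {n : ℕ} {v z : Hom 𝕜 c n n} (hv : BotKilled c v)
    (hz : TopKilled c z) : z (Matching.id n) • v = v (Matching.id n) • z := by
  have h1 := comp_mirror c v z
  rw [hv.comp_eq_smul] at h1
  have h2 := hz.mirrorMap.comp_eq_smul (TwoColorTL.mirrorMap 𝕜 n v)
  have h3 : TwoColorTL.mirrorMap 𝕜 n (z (Matching.id n) • v) =
      TwoColorTL.mirrorMap 𝕜 n (v (Matching.id n) • z) := by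
    rw [map_smul (TwoColorTL.mirrorMap 𝕜 n) (v (Matching.id n)), ← mirrorMap_apply_id v]
    exact h1.symm.trans h2
  rw [← mirrorMap_mirrorMap (z (Matching.id n) • v), h3, mirrorMap_mirrorMap]

/-- Composing `e` with the identity of n - 2 strands with one cup inserted gives exactly the capped
`e`. -/
theorem IsJonesWenzl.botKilled {c : Color} {n : ℕ} {e : Hom 𝕜 c n n} (h : IsJonesWenzl c e) :
    BotKilled c e := by
  intro N hN p hp hpn
  obtain ⟨m, rfl⟩ : ∃ m, n = m + 2 := ⟨n - 2, by omega⟩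
  obtain rfl : N = m + 2 + m := by omega
  have h1 := comp_insertArc c (m + 2 + m - p) p (by omega) (by omega) e (Matching.id m)
  rw [h.2 m (by omega)] at h1
  have h2 := comp_one c (capOff hN p hp (Color.swap^[m + (m + 2 + m - p)] c) e : Hom 𝕜 c m (m + 2))
  rw [Color.swap_iterate_congr c (b := m + (m + 2 + m - p)) ⟨m + m + 2, by omega⟩, ← h2]
  exact h1.symm

/-- From e = e ∘ e = e(1) e, the nonzero coefficient e(1) equals its own square. -/
theorem IsJonesWenzl.apply_id [IsDomain 𝕜] {c : Color} {n : ℕ} {e : Hom 𝕜 c n n}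
    (h : IsJonesWenzl c e) : e (Matching.id n) = 1 := by
  obtain ⟨⟨d, E, h1, -, -, i, rfl⟩, h0⟩ := h.1
  have h2 := (h1 i).1
  rw [IsIdempotent, h.botKilled.comp_eq_smul] at h2
  have h3 := DFunLike.congr_fun h2 (Matching.id n)
  rw [Finsupp.smul_apply, smul_eq_mul] at h3
  exact mul_right_cancel₀ h0 (h3.trans (one_mul _).symm)

theorem IsJonesWenzl.topKilled [IsDomain 𝕜] {c : Color} {n : ℕ} {e : Hom 𝕜 c n n}
    (h : IsJonesWenzl c e) : TopKilled c e := by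
  have h1 := h.botKilled.smul_eq_smul h.botKilled.mirrorMap
  rw [mirrorMap_apply_id, h.apply_id, one_smul, one_smul] at h1
  rw [h1]
  exact h.botKilled.mirrorMap

/-- A rotatable Jones-Wenzl projector stays annihilated by the caps on top when it is rotated. -/
theorem TopKilled.rotCCW {c : Color} {n : ℕ} (hn : 1 ≤ n) {e : Hom 𝕜 c n n} (h : TopKilled c e)
    (hptr : ptr c hn e = 0) : TopKilled c.swap (rotCCW c e) := by
  intro N hN p hp hpn
  refine (capOff_rotateCCW hN p (by omega) _ e).trans ?_
  rw [← Function.iterate_succ_apply]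
  -- The cap of the rotation at `p` is the cap of `e` at `p + 1`: another top cap, or for `p + 2 =
  -- n` the partial trace.
  rcases Nat.lt_or_ge (p + 2) n with h' | h'
  · have := h N hN (p + 1) (by omega) (by omega)
    rw [← add_assoc] at this
    rw [this, map_zero]
  · obtain rfl : n = p + 2 := by omega
    obtain rfl : N = p + 2 - 1 + (p + 2 - 1) := by omega
    rw [Color.swap_iterate_congr c (b := 1) ⟨p + 2, by omega⟩]
    exact (congrArg _ hptr).trans (map_zero _)

/-- Only the hooks at `p - 1`, `p`, `p + 1` become the identity when joined at `p`: the middle one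
closes a circle, its neighbours straighten. -/
theorem capOff_apply_id (m p : ℕ) (hp : p ≤ m) (u : Color) (v : Matching (m + 1 + (m + 1)) →₀ 𝕜) :
    capOff (N := m + m) (by omega) p (by omega) u v (Matching.id m) =
      circleValue 𝕜 u * v (hook m p) + (if 0 < p then v (hook m (p - 1)) else 0) +
        (if p < m then v (hook m (p + 1)) else 0) := by
  induction v using Finsupp.induction_linear with
  | zero => simp
  | add f₁ f₂ h₁ h₂ =>
    rw [map_add, Finsupp.add_apply, h₁, h₂]
    simp only [Finsupp.add_apply]
    split_ifs <;> ring
  | single M x =>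
    have f1 : M = hook m p → M.join (N := m + m) (by omega) p (by omega) = Matching.id m ∧
        M.partner p = p + 1 := by
      rintro rfl
      exact ⟨join_hook hp, by simp [hook_partner (by omega : p ≤ m + m)]⟩
    have f2 : 0 < p → M = hook m (p - 1) →
        M.join (N := m + m) (by omega) p (by omega) = Matching.id m ∧ M.partner p + 1 = p := by
      rintro h0 rfl
      obtain ⟨q, rfl⟩ : ∃ q, p = q + 1 := ⟨p - 1, by omega⟩
      refine ⟨join_hook_pred hp, ?_⟩
      simp [hook_partner (by omega : q ≤ m + m)]
    have f3 : p < m → M = hook m (p + 1) →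
        M.join (N := m + m) (by omega) p (by omega) = Matching.id m ∧ p + 1 < M.partner p := by
      rintro h0 rfl
      refine ⟨join_hook_succ h0, ?_⟩
      simp only [hook_partner (by omega : p + 1 ≤ m + m), Matching.id, insertTwo, removeTwo]
      grind
    have f4 := M.eq_hook_of_join hp
    classical
    simp only [capOff_single, Finsupp.single_apply]
    generalize M.join (N := m + m) _ p _ = J at *
    grind

end
end TwoColorTL

/-! ### Hook coefficients as quantum numbers, and the rotated projector. -/

noncomputable section

namespace TwoColorTL

open Matching

section

variable {𝕜 : Type*} [CommRing 𝕜] [Algebra A 𝕜]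

theorem quantum_add_two (n : ℕ) (c : Color) :
    quantum 𝕜 (n + 2) c =
      quantum 𝕜 (n + 1) c.swap * algebraMap A 𝕜 (MvPolynomial.X c) - quantum 𝕜 n c := by
  simp [quantum, qnum]

theorem quantum_mul_sub (m : ℕ) (c : Color) :
    quantum 𝕜 (m + 1) c * quantum 𝕜 (m + 1) c.swap -
      quantum 𝕜 (m + 2) c * quantum 𝕜 m c.swap = 1 := by
  have := congrArg (algebraMap A 𝕜) (qnum_mul_sub m c)
  simpa [quantum] using this

/-- The coefficients of the hooks in an element annihilated by the caps on top. -/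
theorem TopKilled.apply_hook {m : ℕ} {c : Color} {v : Hom 𝕜 c (m + 1) (m + 1)}
    (h : TopKilled c v) (p : ℕ) (hp : p ≤ m) :
    v (hook m p) = v (hook m 0) * quantum 𝕜 (p + 1) (Color.swap^[m + p] c) := by
  induction p using Nat.strong_induction_on with
  | _ p ih =>
    rcases p with _ | q
    · simp [quantum, qnum]
    ·
      -- The identity coefficient of the vanishing cap at `q` expresses the hook `q + 1` through the
      -- hooks `q` and `q - 1`, by the recursion of the quantum numbers.
      have h1 := DFunLike.congr_fun (h (m + m) (by omega) q (by omega) (by omega)) (Matching.id m)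
      rw [capOff_apply_id m q (by omega), if_pos (by omega : q < m), circleValue,
        Finsupp.zero_apply, ih q (by omega) (by omega)] at h1
      have hs : ∀ j, Color.swap^[j + 1] c = (Color.swap^[j] c).swap := fun j =>
        Function.iterate_succ_apply' _ _ _
      rw [show m + 1 + q = m + q + 1 by omega, hs] at h1
      rw [quantum_add_two, ← add_assoc m q 1, hs, Color.swap_swap]
      by_cases hq : 0 < q
      · rw [if_pos hq, ih (q - 1) (by omega) (by omega)] at h1
        obtain ⟨r, rfl⟩ : ∃ r, q = r + 1 := ⟨q - 1, by omega⟩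
        rw [← add_assoc m r 1, hs, Color.swap_swap, Nat.add_sub_cancel] at h1
        rw [← add_assoc m r 1, hs, Color.swap_swap]
        linear_combination h1
      · obtain rfl : q = 0 := by omega
        -- At `q = 0` there is no hook to the left, which matches [0] = 0.
        have hz : ∀ d, quantum 𝕜 0 d = 0 := fun d => by simp [quantum, qnum]
        rw [if_neg (by omega)] at h1
        rw [hz]
        linear_combination h1

theorem IsJonesWenzl.apply_hook_zero [IsDomain 𝕜] {m : ℕ} {c : Color}
    {e : Hom 𝕜 c (m + 1) (m + 1)} (h : IsJonesWenzl c e) :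
    e (hook m 0) * quantum 𝕜 (m + 1) c = 1 := by
  have h1 := h.topKilled.apply_hook m le_rfl
  rw [hook_self, h.apply_id, Color.swap_iterate_congr c (a := m + m) (b := 0) ⟨m, rfl⟩] at h1
  exact h1.symm

/-- If the Jones-Wenzl projector on `m + 1` strands is rotatable, then the quantum number
`[m + 2]` vanishes. -/
theorem IsJonesWenzl.quantum_eq_zero [IsDomain 𝕜] {m : ℕ} {c : Color}
    {e : Hom 𝕜 c (m + 1) (m + 1)} (h : IsJonesWenzl c e)
    (hptr : ptr c (Nat.le_add_left 1 m) e = 0) : quantum 𝕜 (m + 2) c.swap = 0 := by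
  have h0 := h.apply_hook_zero
  have h1 : capOff (N := m + m) (by omega) m (by omega) c.swap e (Matching.id m) = 0 :=
    DFunLike.congr_fun hptr (Matching.id m)
  have hm := h.topKilled.apply_hook m le_rfl
  rw [Color.swap_iterate_congr c (a := m + m) (b := 0) ⟨m, rfl⟩] at hm
  -- The recursion goes one step further, at the partial trace: there is no hook `m + 1` term, so
  -- the value predicted for it must vanish.
  have key : e (hook m 0) * quantum 𝕜 (m + 2) c.swap = 0 := by
    rw [capOff_apply_id m m le_rfl, if_neg (lt_irrefl m), circleValue, hm] at h1
    rw [quantum_add_two, Color.swap_swap]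
    by_cases hq : 0 < m
    · rw [if_pos hq, h.topKilled.apply_hook (m - 1) (by omega),
        Color.swap_iterate_congr c (a := m + (m - 1)) (b := 1) ⟨m, by omega⟩, Nat.sub_add_cancel hq] at h1
      simp only [Function.iterate_zero, id_eq, Function.iterate_one] at h1
      linear_combination -h1
    · obtain rfl : m = 0 := by omega
      have hz : quantum 𝕜 0 c.swap = 0 := by simp [quantum, qnum]
      simp only [Function.iterate_zero, id_eq, lt_irrefl, if_false] at h1
      rw [hz]
      linear_combination -h1
  calc quantum 𝕜 (m + 2) c.swap
      = e (hook m 0) * quantum 𝕜 (m + 2) c.swap * quantum 𝕜 (m + 1) c := by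
        linear_combination (-quantum 𝕜 (m + 2) c.swap) * h0
    _ = 0 := by rw [key, zero_mul]

theorem rotCCW_apply_rotateCCW (c : Color) {n : ℕ} (v : Hom 𝕜 c n n) (M : Matching (n + n)) :
    rotCCW c v M.rotateCCW = v M :=
  Finsupp.mapDomain_apply (Function.LeftInverse.injective rotateCW_rotateCCW) _ _

theorem rotCW_rotCCW (c d : Color) {n : ℕ} (v : Hom 𝕜 c n n) : rotCW d (rotCCW c v) = v := by
  simp only [rotCW, rotCCW, Finsupp.lmapDomain_apply]
  rw [← Finsupp.mapDomain_comp]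
  convert Finsupp.mapDomain_id
  ext M : 1
  exact rotateCW_rotateCCW M

/-- The rotation is top-killed, hence a multiple of `e'`. The factor is its identity coefficient,
that is, the coefficient of the hook at `0` in `e`; this and [n]_{c'} are both inverse to [n]_c. -/
theorem IsJonesWenzl.rotCCW_eq [IsDomain 𝕜] {n : ℕ} (hn : 1 ≤ n) {c : Color} {e : Hom 𝕜 c n n}
    {e' : Hom 𝕜 c.swap n n} (h : IsJonesWenzl c e) (h' : IsJonesWenzl c.swap e')
    (hptr : ptr c hn e = 0) (hq : quantum 𝕜 n c * quantum 𝕜 n c.swap = 1) :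
    rotCCW c e = quantum 𝕜 n c.swap • e' := by
  have h1 := h'.botKilled.smul_eq_smul (h.topKilled.rotCCW hn hptr)
  obtain ⟨m, rfl⟩ : ∃ m, n = m + 1 := ⟨n - 1, by omega⟩
  rw [h'.apply_id, one_smul] at h1
  rw [← h1]
  congr 1
  rw [← rotateCCW_rotateCW (Matching.id (m + 1)), rotCCW_apply_rotateCCW, ← hook_zero]
  linear_combination (-e (hook m 0)) * hq + quantum 𝕜 (m + 1) c.swap * h.apply_hook_zero

theorem Matching.rotateCCW_iterate_id {n : ℕ} : rotateCCW^[n] (Matching.id n) = Matching.id n := by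
  -- After j rotations partners sum to -1 - 2j modulo 2n; the two branches choose the representative
  -- in range. At j = n the identity returns.
  have key : ∀ j, j ≤ n → ∀ i, (rotateCCW^[j] (Matching.id n)).partner i =
      if i < n + n then (if i + 2 * j < n + n then n + n - 1 - 2 * j - i
        else 2 * (n + n) - 1 - 2 * j - i) else i := by
    intro j
    induction j with
    | zero => intro _ i; simp only [Function.iterate_zero, id_eq, Matching.id]; grind
    | succ j ih =>
      intro hj i
      have h1 := ih (by omega) (next (n + n) i)
      have h2 := next_spec (n + n) i
      have h3 := prev_spec (n + n) ((rotateCCW^[j] (Matching.id n)).partner (next (n + n) i))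
      rw [Function.iterate_succ_apply']
      show (if i < n + n then prev (n + n) _ else i) = _
      grind
  ext i
  rw [key n le_rfl]
  simp only [Matching.id]
  grind

end

end TwoColorTL
end

/-! ### The rotation statement. -/

open TwoColorTL in
theorem lemma6p9 {𝕜 : Type*} [CommRing 𝕜] [IsDomain 𝕜] [HenselianLocalRing 𝕜]
    [Algebra A 𝕜] (n : ℕ) (hn : 1 ≤ n)
    (JWs : Hom 𝕜 Color.s n n) (JWt : Hom 𝕜 Color.t n n)
    (hJWs : IsJonesWenzl Color.s JWs) (hJWt : IsJonesWenzl Color.t JWt)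
    (hrot : ptr Color.s hn JWs = 0 ∧ ptr Color.t hn JWt = 0) :
    (rotCCW Color.s JWs = quantum 𝕜 n Color.t • JWt ∧
      rotCW Color.s JWs = quantum 𝕜 n Color.t • JWt) ∧
    (rotCCW Color.t JWt = quantum 𝕜 n Color.s • JWs ∧
      rotCW Color.t JWt = quantum 𝕜 n Color.s • JWs) ∧
    quantum 𝕜 n Color.s * quantum 𝕜 n Color.t = 1 ∧
    (rotCCW Color.t (rotCCW Color.s JWs) = JWs ∧ rotCW Color.t (rotCW Color.s JWs) = JWs) ∧
    (rotCCW Color.s (rotCCW Color.t JWt) = JWt ∧ rotCW Color.s (rotCW Color.t JWt) = JWt) ∧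
    (Odd n → quantum 𝕜 n Color.s = 1 ∧ quantum 𝕜 n Color.t = 1) := by
  have hq : quantum 𝕜 n Color.s * quantum 𝕜 n Color.t = 1 := by
    obtain ⟨m, rfl⟩ : ∃ m, n = m + 1 := ⟨n - 1, by omega⟩
    have h0 : quantum 𝕜 (m + 2) Color.s = 0 := hJWt.quantum_eq_zero hrot.2
    have h1 := quantum_mul_sub (𝕜 := 𝕜) m Color.s
    rwa [h0, zero_mul, sub_zero] at h1
  have hq' : quantum 𝕜 n Color.t * quantum 𝕜 n Color.s = 1 := by rw [mul_comm, hq]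
  have hs : rotCCW Color.s JWs = quantum 𝕜 n Color.t • JWt := hJWs.rotCCW_eq hn hJWt hrot.1 hq
  have ht : rotCCW Color.t JWt = quantum 𝕜 n Color.s • JWs := hJWt.rotCCW_eq hn hJWs hrot.2 hq'
  have hs' : rotCW Color.s JWs = quantum 𝕜 n Color.t • JWt := by
    -- Clockwise rotation inverts counterclockwise rotation, so it suffices to undo `ht` and
    -- multiply by [n]_t, the inverse of [n]_s.
    have h := rotCW_rotCCW Color.t Color.s JWt
    rw [ht, map_smul] at h
    have h2 := congrArg (fun v => quantum 𝕜 n Color.t • v) h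
    simp only [smul_smul, hq', one_smul] at h2
    exact h2
  have ht' : rotCW Color.t JWt = quantum 𝕜 n Color.s • JWs := by
    have h := rotCW_rotCCW Color.s Color.t JWs
    rw [hs, map_smul] at h
    have h2 := congrArg (fun v => quantum 𝕜 n Color.s • v) h
    simp only [smul_smul, hq, one_smul] at h2
    exact h2
  refine ⟨⟨hs, hs'⟩, ⟨ht, ht'⟩, hq, ⟨?_, ?_⟩, ⟨?_, ?_⟩, fun hodd => ?_⟩
  · rw [hs, map_smul, ht, smul_smul, hq', one_smul]
  · rw [hs', map_smul, ht', smul_smul, hq', one_smul]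
  · rw [ht, map_smul, hs, smul_smul, hq, one_smul]
  · rw [ht', map_smul, hs', smul_smul, hq, one_smul]
  · obtain ⟨j, rfl⟩ := hodd
    -- The color does not affect the type `Hom`, so the rotations for both colors are one linear
    -- map, which can be iterated.
    have hiter : ∀ i, (Finsupp.lmapDomain 𝕜 𝕜 Matching.rotateCCW)^[2 * i] JWs = JWs := by
      intro i
      induction i with
      | zero => rfl
      | succ i ih =>
        rw [show 2 * (i + 1) = 2 * i + 1 + 1 by omega, Function.iterate_succ_apply',
          Function.iterate_succ_apply', ih]
        change rotCCW Color.t (rotCCW Color.s JWs) = JWs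
        rw [hs, map_smul, ht, smul_smul, hq', one_smul]
    have hcoeff : ∀ i, ((Finsupp.lmapDomain 𝕜 𝕜 Matching.rotateCCW)^[i] JWs)
        (Matching.rotateCCW^[i] (Matching.id (2 * j + 1))) = JWs (Matching.id (2 * j + 1)) := by
      intro i
      induction i with
      | zero => rfl
      | succ i ih =>
        rw [Function.iterate_succ_apply', Function.iterate_succ_apply', ← ih]
        exact rotCCW_apply_rotateCCW Color.s _ _
    have h1 := hcoeff (2 * j + 1)
    -- Of the `2 * j + 1` rotations all but the last cancel in pairs on `JWs`, while all of them
    -- together fix the identity matching. Comparing its coefficients gives [n]_t = 1.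
    rw [Matching.rotateCCW_iterate_id, Function.iterate_succ_apply', hiter, hJWs.apply_id] at h1
    change rotCCW Color.s JWs _ = 1 at h1
    rw [hs, Finsupp.smul_apply, hJWt.apply_id, smul_eq_mul, mul_one] at h1
    rw [h1, mul_one] at hq
    exact ⟨hq, h1⟩
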